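/- Let $0<p<1$ and let $Y_1,Y_2,\ldots$ be i.i.d. with $\Pr(Y_i=k)=(1-p)^k p$ for $k=0,1,2,\ldots$. For $n\ge 1$ let $L_n$ be the length of the longest gap in the sample $Y_1,\ldots,Y_n$, that is, the largest number of consecutive integers in $\{\min_i Y_i,\ldots,\max_i Y_i\}$ none of which equals any of $Y_1,\ldots,Y_n$ (so $L_n=0$ if there is no such integer). Then $L_n$ is square integrable, and for all $0<p<1$ and $n\ge1$ \begin{align*} \mathbb{E}L_n &\in\left[\frac{(1-p)^2}{p}-\frac{(1-p)^{2n}}{1-(1-p)^n},\ \frac{1.5}{p}+1\right],\\ \mathbb{E}L_n^2 &\in\left[\frac{2(1-p)^2}{p^2}-\frac{2(1-p)^{2n}}{(1-(1-p)^n)^2},\ \frac{3.3}{p^2}+\frac{3}{2p}+2\right],\\ \mathrm{Var}(L_n) &\in\left[0,\ \frac{3.3}{p^2}+\frac{3}{2p}+2-\left(\frac{(1-p)^2}{p}-\frac{(1-p)^{2n}}{1-(1-p)^n}\right)^2\right]. \end{align*} Write $f\,\tilde\in\,[a,b]$ in a given limit if for every $\varepsilon>0$ one eventually has $a-\varepsilon|a|\le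 f\le b+\varepsilon|b|$ (for positive $a,b$: $\liminf f/a\ge 1$ and $\limsup f/b\le 1$). Then, for every fixed $p\in(0,1)$ as $n\to\infty$, and for every fixed $n\ge1$ as $p\to0^+$ and as $p\to1^-$, \[ \begin{array}{rccc} & n\to\infty & p\to0^{+} & p\to1^{-}\\ \mathbb{E}L_{n}\,\tilde{\in} & \left[\frac{(1-p)^{2}}{p},\ \frac{1.5}{p}+1\right], & \left[\frac{n-1}{np},\ \frac{1.5}{p}\right], & [0,\ 2.5],\\ \mathbb{E}L_{n}^{2}\,\tilde{\in} & \left[\frac{2(1-p)^{2}}{p^{2}},\ \frac{3.3}{p^{2}}+\frac{3}{2p}+2\right], & \left[\frac{2n^{2}(1-p)^{2}-2}{n^{2}p^{2}},\ \frac{3.3}{p^{2}}\right], & [0,\ 6.8],\\ \mathrm{Var}(L_{n})\,\tilde{\in} & \left[0,\ \frac{2.3}{p^{2}}+\frac{5.5}{p}\right], & \left[0,\ \frac{2.3n^{2}+2n-1}{n^{2}p^{2}}\right], & [0,\ 6.8]. \end{array} \] -/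

import Mathlib

open MeasureTheory ProbabilityTheory Filter Topology Set

/-- `Y 0, Y 1, …` are i.i.d. under the probability measure `μ`, with
`Pr (Y i = k) = (1 - p) ^ k * p` for `k = 0, 1, 2, …`. -/
structure IsIIDGeometric {Ω : Type*} [MeasurableSpace Ω] (μ : Measure Ω) (Y : ℕ → Ω → ℕ)
    (p : ℝ) : Prop where
  isProbabilityMeasure : IsProbabilityMeasure μ
  measurable : ∀ i, Measurable (Y i)
  indep : iIndepFun Y μ
  law : ∀ i k, μ.real {ω | Y i ω = k} = (1 - p) ^ k * p

/-- A gap of length `l` starting at `a` in the set `s` of occupied bins: the `l` consecutive bins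
`a, …, a + l - 1` are all empty and all lie in the range from the smallest to the largest
occupied bin. -/
def IsGap (s : Finset ℕ) (a l : ℕ) : Prop :=
  ∀ k ∈ Finset.Ico a (a + l), k ∉ s ∧ (∃ i ∈ s, i ≤ k) ∧ (∃ j ∈ s, k ≤ j)

/-- The length of the longest gap in the set `s` of occupied bins (`0` if there is no empty bin
between the smallest and the largest occupied bin). -/
noncomputable def longestGap (s : Finset ℕ) : ℕ :=
  sSup {l : ℕ | ∃ a, IsGap s a l}

/-- The set of gap lengths is bounded, so that the supremum in `longestGap` is a maximum. -/
theorem bddAbove_gapLengths (s : Finset ℕ) : BddAbove {l : ℕ | ∃ a, IsGap s a l} := by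
  refine ⟨s.sup id, ?_⟩
  rintro l ⟨a, h⟩
  rcases Nat.eq_zero_or_pos l with rfl | hl
  · exact Nat.zero_le _
  · obtain ⟨-, ⟨i, hi, hia⟩, -⟩ := h a (by simp; omega)
    obtain ⟨hs, -, ⟨j, hj, hlj⟩⟩ := h (a + l - 1) (by simp; omega)
    have h1 : j ≤ s.sup id := Finset.le_sup (f := id) hj
    have h2 : j ≠ a + l - 1 := fun e => hs (e ▸ hj)
    omega

/-- `L_n`, the length of the longest gap left by the sample `Y 0, …, Y (n - 1)`, as a real random
variable. -/
noncomputable def gapLength {Ω : Type*} (Y : ℕ → Ω → ℕ) (n : ℕ) (ω : Ω) : ℝ :=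
  (longestGap ((Finset.range n).image fun i => Y i ω) : ℝ)

/-- `lo` and `hi` are asymptotic lower and upper bounds of `f` along the filter `F`:
for every `ε > 0`, eventually `lo - ε |lo| ≤ f ≤ hi + ε |hi|`. For positive `lo` and `hi` this says
`liminf f / lo ≥ 1` and `limsup f / hi ≤ 1`; where a bound is `0` it says that the inequality
holds eventually. -/
def AsympMem {α : Type*} (F : Filter α) (f lo hi : α → ℝ) : Prop :=
  ∀ ε > 0, ∀ᶠ x in F, lo x - ε * |lo x| ≤ f x ∧ f x ≤ hi x + ε * |hi x|

/-- The sample values `y i`, `i ∈ S`, are all at least `a`, and above `a` they leave `j` consecutive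
empty bins below the largest of them. -/
def gapAbove (S : Finset ℕ) (j a : ℕ) : Set (S → ℕ) :=
  {y | (∀ i, a ≤ y i) ∧ ∃ b, a ≤ b ∧ (∀ i, y i < b ∨ b + j ≤ y i) ∧ ∃ i, b + j ≤ y i}

/-- The probability that one of `m` independent events occurs, when the `i`-th has probability
`x ^ i`. -/
noncomputable def gapTail (x : ℝ) (m : ℕ) : ℝ := 1 - ∏ i ∈ Finset.range m, (1 - x ^ (i + 1))

section gapTail

variable {x : ℝ}

theorem gapTail_succ (x : ℝ) (m : ℕ) :
    gapTail x (m + 1) = x ^ (m + 1) + (1 - x ^ (m + 1)) * gapTail x m := by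
  simp only [gapTail, Finset.prod_range_succ]; ring

theorem gapTail_le_one (h0 : 0 ≤ x) (h1 : x ≤ 1) (m : ℕ) : gapTail x m ≤ 1 := by
  have : 0 ≤ ∏ i ∈ Finset.range m, (1 - x ^ (i + 1)) :=
    Finset.prod_nonneg fun i _ => sub_nonneg.2 (pow_le_one₀ h0 h1)
  unfold gapTail; linarith

theorem gapTail_mono (h0 : 0 ≤ x) (h1 : x ≤ 1) : Monotone (gapTail x) := by
  refine monotone_nat_of_le_succ fun m => ?_
  have h := mul_nonneg (pow_nonneg h0 (m + 1)) (sub_nonneg.2 (gapTail_le_one h0 h1 m))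
  rw [gapTail_succ]; nlinarith

theorem gapTail_le (h0 : 0 ≤ x) (h1 : x ≤ 1) (m : ℕ) : gapTail x m ≤ x + x ^ 2 := by
  have key : ∀ m, x ≤ gapTail x (m + 1) ∧ gapTail x (m + 1) ≤ x + x ^ 2 - x ^ (m + 2) := by
    intro m
    induction m with
    | zero => simp [gapTail]
    | succ m ih =>
      refine ⟨ih.1.trans (gapTail_mono h0 h1 (Nat.le_succ _)), ?_⟩
      have h := mul_nonneg (pow_nonneg h0 (m + 2)) (sub_nonneg.2 ih.1)
      rw [gapTail_succ x (m + 1)]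
      have e : x ^ (m + 1 + 2) = x ^ (m + 2) * x := by ring
      rw [e]
      have e2 : x ^ (m + 1 + 1) = x ^ (m + 2) := by ring
      rw [e2]
      nlinarith [ih.2]
  cases m with
  | zero => simp [gapTail]; positivity
  | succ m => have := (key m).2; have := pow_nonneg h0 (m + 2); linarith

end gapTail

/-- Union bound over the value of the minimum and the set of indices where it is not attained. -/
theorem setOf_gapAbove_subset {Ω : Type*} (Y : ℕ → Ω → ℕ) (S : Finset ℕ) (j a : ℕ) :
    {ω | (fun i : S => Y i ω) ∈ gapAbove S j a} ⊆ {ω | ∀ i ∈ S, Y i ω ∈ Ici (a + j)} ∪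
      ⋃ k ∈ Finset.range j, ⋃ T ∈ S.ssubsets,
        {ω | (fun i : (S \ T : Finset ℕ) => Y i ω) ∈ {y | ∀ i, y i = a + k} ∧
          (fun i : T => Y i ω) ∈ gapAbove T j (a + k + 1)} := by
  rintro ω ⟨ha, b, hab, hb, ⟨i₁, hi₁⟩, hbi⟩
  simp only at ha hb hbi
  obtain ⟨i₀, hi₀, hmin⟩ := S.exists_min_image (fun i => Y i ω) ⟨i₁, hi₁⟩
  by_cases hM : a + j ≤ Y i₀ ω
  · exact Or.inl fun i hi => hM.trans (hmin i hi)
  right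
  have ha₀ := ha ⟨i₀, hi₀⟩
  have hb₀ := hb ⟨i₀, hi₀⟩
  simp only at ha₀ hb₀
  simp only [mem_iUnion]
  refine ⟨Y i₀ ω - a, Finset.mem_range.2 (by omega), S.filter fun i => Y i ω ≠ Y i₀ ω,
    Finset.mem_ssubsets.2 ⟨Finset.filter_subset _ _, fun hsub => ?_⟩, ?_, ?_, b, ?_, ?_, ?_⟩
  · simpa using hsub hi₀
  · rintro ⟨i, hi⟩
    simp only [Finset.mem_sdiff, Finset.mem_filter, not_and, not_not] at hi
    have := hi.2 hi.1
    simp only; omega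
  · rintro ⟨i, hi⟩
    rw [Finset.mem_filter] at hi
    have := hmin i hi.1
    simp only; omega
  · omega
  · rintro ⟨i, hi⟩
    exact hb ⟨i, (Finset.mem_filter.1 hi).1⟩
  · exact ⟨⟨i₁, Finset.mem_filter.2 ⟨hi₁, by omega⟩⟩, hbi⟩

namespace IsIIDGeometric

variable {Ω : Type*} [MeasurableSpace Ω] {μ : Measure Ω} {Y : ℕ → Ω → ℕ} {p : ℝ}

theorem measurableSet_eq (h : IsIIDGeometric μ Y p) (i k : ℕ) : MeasurableSet {ω | Y i ω = k} :=
  h.measurable i (measurableSet_singleton k)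

theorem real_lt (h : IsIIDGeometric μ Y p) (i k : ℕ) :
    μ.real {ω | Y i ω < k} = 1 - (1 - p) ^ k := by
  have := h.isProbabilityMeasure
  induction k with
  | zero => simp
  | succ k ih =>
    have e : {ω | Y i ω < k + 1} = {ω | Y i ω < k} ∪ {ω | Y i ω = k} := by
      ext ω; simp only [mem_ofPred_eq, mem_union]; omega
    rw [e, measureReal_union _ (h.measurableSet_eq i k), ih, h.law]
    · ring
    · exact Set.disjoint_left.2 fun ω h1 h2 => by simp only [mem_ofPred_eq] at h1 h2; omega

theorem real_ge (h : IsIIDGeometric μ Y p) (i k : ℕ) :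
    μ.real {ω | k ≤ Y i ω} = (1 - p) ^ k := by
  have := h.isProbabilityMeasure
  have e : {ω | k ≤ Y i ω} = {ω | Y i ω < k}ᶜ := by ext; simp
  have hm : MeasurableSet {ω | Y i ω < k} := h.measurable i (measurableSet_Iio (a := k))
  rw [e, measureReal_compl hm, h.real_lt]; simp

theorem real_forall (h : IsIIDGeometric μ Y p) (S : Finset ℕ) (A : ℕ → Set ℕ) :
    μ.real {ω | ∀ i ∈ S, Y i ω ∈ A i} = ∏ i ∈ S, μ.real {ω | Y i ω ∈ A i} := by
  have := h.indep.measure_inter_preimage_eq_mul S (sets := A) fun i _ => MeasurableSet.of_discrete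
  have e : {ω | ∀ i ∈ S, Y i ω ∈ A i} = ⋂ i ∈ S, Y i ⁻¹' A i := by ext; simp
  rw [Measure.real, e, this, ENNReal.toReal_prod]; rfl

theorem real_inter (h : IsIIDGeometric μ Y p) {S T : Finset ℕ} (hST : Disjoint S T)
    (A : Set (S → ℕ)) (B : Set (T → ℕ)) :
    μ.real {ω | (fun i : S => Y i ω) ∈ A ∧ (fun i : T => Y i ω) ∈ B} =
      μ.real {ω | (fun i : S => Y i ω) ∈ A} * μ.real {ω | (fun i : T => Y i ω) ∈ B} := by
  have := (h.indep.indepFun_finset S T hST h.measurable).measure_inter_preimage_eq_mul A B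
    MeasurableSet.of_discrete MeasurableSet.of_discrete
  simp only [Measure.real, ← ENNReal.toReal_mul]
  exact congrArg _ this

theorem real_gapAbove_le (h : IsIIDGeometric μ Y p) (hp : p ∈ Ioo (0 : ℝ) 1) (j : ℕ)
    (S : Finset ℕ) : ∀ a, μ.real {ω | (fun i : S => Y i ω) ∈ gapAbove S j a} ≤
      (1 - p) ^ (a * S.card) * gapTail ((1 - p) ^ j) S.card := by
  have := h.isProbabilityMeasure
  have hq0 : 0 < 1 - p := by linarith [hp.2]
  have hq1 : 1 - p < 1 := by linarith [hp.1]
  have hx0 : 0 ≤ (1 - p) ^ j := by positivity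
  have hx1 : (1 - p) ^ j ≤ 1 := pow_le_one₀ hq0.le hq1.le
  induction S using Finset.strongInduction with
  | H S ih =>
    intro a
    rcases S.eq_empty_or_nonempty with rfl | hS
    · simp [gapAbove, gapTail]
    obtain ⟨m, hm⟩ : ∃ m, S.card = m + 1 := ⟨S.card - 1, by have := hS.card_pos; omega⟩
    have hterm : ∀ k, ∀ T ∈ S.ssubsets,
        μ.real {ω | (fun i : (S \ T : Finset ℕ) => Y i ω) ∈ {y | ∀ i, y i = a + k} ∧
          (fun i : T => Y i ω) ∈ gapAbove T j (a + k + 1)} ≤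
        (1 - p) ^ ((a + k) * (m + 1)) * gapTail ((1 - p) ^ j) m *
          ((1 - p) ^ T.card * p ^ (S.card - T.card)) := by
      intro k T hT
      rw [Finset.mem_ssubsets] at hT
      have hcard := Finset.card_lt_card hT
      rw [h.real_inter Finset.sdiff_disjoint]
      have e : {ω | (fun i : (S \ T : Finset ℕ) => Y i ω) ∈ {y | ∀ i, y i = a + k}} =
          {ω | ∀ i ∈ S \ T, Y i ω ∈ ({a + k} : Set ℕ)} := by
        ext ω; simp
      have hc : (S \ T).card = S.card - T.card := Finset.card_sdiff_of_subset hT.1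
      have e1 : μ.real {ω | ∀ i ∈ S \ T, Y i ω ∈ ({a + k} : Set ℕ)} =
          ((1 - p) ^ (a + k) * p) ^ (S.card - T.card) := by
        rw [h.real_forall (S \ T) (fun _ => {a + k})]
        simp only [mem_singleton_iff, h.law, Finset.prod_const, hc]
      rw [e, e1]
      have hb : gapTail ((1 - p) ^ j) T.card ≤ gapTail ((1 - p) ^ j) m :=
        gapTail_mono hx0 hx1 (by omega)
      have hp0 := hp.1
      calc _ ≤ ((1 - p) ^ (a + k) * p) ^ (S.card - T.card) *
            ((1 - p) ^ ((a + k + 1) * T.card) * gapTail ((1 - p) ^ j) m) := by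
            gcongr
            exact (ih T hT _).trans (by gcongr)
        _ = _ := by
            have e2 : (a + k) * (m + 1) = (a + k) * (S.card - T.card) + (a + k) * T.card := by
              rw [← mul_add, hm]; congr 1; omega
            rw [e2]; ring
    have hsum : ∑ T ∈ S.ssubsets, (1 - p) ^ T.card * p ^ (S.card - T.card) =
        1 - (1 - p) ^ (m + 1) := by
      have h1 := Finset.sum_pow_mul_eq_add_pow (1 - p) p S
      rw [sub_add_cancel, one_pow, ← Finset.insert_erase (Finset.mem_powerset_self S),
        Finset.sum_insert (Finset.notMem_erase _ _)] at h1
      simp only [Nat.sub_self, pow_zero, mul_one] at h1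
      rw [← hm, Finset.ssubsets]; linarith
    have hgeom : (∑ k ∈ Finset.range j, (1 - p) ^ ((a + k) * (m + 1))) * (1 - (1 - p) ^ (m + 1)) =
        (1 - p) ^ (a * (m + 1)) * (1 - ((1 - p) ^ j) ^ (m + 1)) := by
      have := geom_sum_mul_neg ((1 - p) ^ (m + 1)) j
      rw [← pow_mul (1 - p) j, mul_comm j, pow_mul (1 - p) _ j, ← this, ← mul_assoc,
        Finset.mul_sum]
      congr 1
      refine Finset.sum_congr rfl fun k _ => ?_
      rw [← pow_mul, ← pow_add]; congr 1; ring
    calc _ ≤ μ.real {ω | ∀ i ∈ S, Y i ω ∈ Ici (a + j)} + ∑ k ∈ Finset.range j,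
          ∑ T ∈ S.ssubsets, (1 - p) ^ ((a + k) * (m + 1)) * gapTail ((1 - p) ^ j) m *
          ((1 - p) ^ T.card * p ^ (S.card - T.card)) := by
          refine (measureReal_mono (setOf_gapAbove_subset Y S j a)).trans
            ((measureReal_union_le _ _).trans (add_le_add le_rfl ?_))
          refine (measureReal_biUnion_finset_le _ _).trans (Finset.sum_le_sum fun k _ => ?_)
          exact (measureReal_biUnion_finset_le _ _).trans (Finset.sum_le_sum fun T hT => hterm k T hT)
      _ = (1 - p) ^ (a * (m + 1)) * (((1 - p) ^ j) ^ (m + 1) +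
          (1 - ((1 - p) ^ j) ^ (m + 1)) * gapTail ((1 - p) ^ j) m) := by
          rw [h.real_forall S (fun _ => Ici (a + j))]
          simp only [mem_Ici, h.real_ge, Finset.prod_const, hm]
          simp only [← Finset.mul_sum]
          rw [hm] at hsum
          rw [hsum, ← Finset.sum_mul, ← Finset.sum_mul, mul_right_comm, hgeom]
          ring
      _ = _ := by rw [hm, gapTail_succ]

end IsIIDGeometric

theorem exists_isGap_of_le_longestGap {s : Finset ℕ} {j : ℕ} (hj : j ≤ longestGap s) :
    ∃ a, IsGap s a j := by
  have hne : {l : ℕ | ∃ a, IsGap s a l}.Nonempty := ⟨0, 0, fun k hk => by simp at hk⟩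
  obtain ⟨a, ha⟩ := Nat.sSup_mem hne (bddAbove_gapLengths s)
  refine ⟨a, fun k hk => ha k ?_⟩
  have : j ≤ sSup {l : ℕ | ∃ a, IsGap s a l} := hj
  rw [Finset.mem_Ico] at hk ⊢
  omega

theorem le_longestGap {s : Finset ℕ} {a j : ℕ} (h : IsGap s a j) : j ≤ longestGap s :=
  le_csSup (bddAbove_gapLengths s) ⟨a, h⟩

namespace IsIIDGeometric

variable {Ω : Type*} [MeasurableSpace Ω] {μ : Measure Ω} {Y : ℕ → Ω → ℕ} {p : ℝ}

theorem measurable_longestGap (h : IsIIDGeometric μ Y p) (n : ℕ) :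
    Measurable fun ω => longestGap ((Finset.range n).image fun i => Y i ω) := by
  have h1 : Measurable fun (ω : Ω) (i : Finset.range n) => Y i ω :=
    measurable_pi_lambda _ fun i => h.measurable i
  have h2 : Measurable fun y : Finset.range n → ℕ =>
      longestGap (Finset.univ.image y) := Measurable.of_discrete
  convert h2.comp h1 using 2 with ω
  refine congrArg longestGap (Finset.ext fun k => ?_)
  simp

theorem real_longestGap_le (h : IsIIDGeometric μ Y p) (hp : p ∈ Ioo (0 : ℝ) 1) (n j : ℕ) :
    μ.real {ω | j + 1 ≤ longestGap ((Finset.range n).image fun i => Y i ω)} ≤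
      (1 - p) ^ (j + 1) + ((1 - p) ^ (j + 1)) ^ 2 := by
  have := h.isProbabilityMeasure
  have hq0 : 0 < 1 - p := by linarith [hp.2]
  have hq1 : 1 - p < 1 := by linarith [hp.1]
  have hle := h.real_gapAbove_le hp (j + 1) (Finset.range n) 0
  rw [zero_mul, pow_zero, one_mul] at hle
  refine le_trans (measureReal_mono ?_) (hle.trans
    (gapTail_le (by positivity) (pow_le_one₀ hq0.le hq1.le) _))
  intro ω hω
  obtain ⟨a, ha⟩ := exists_isGap_of_le_longestGap hω
  have hempty : ∀ i : Finset.range n, Y i ω < a ∨ a + (j + 1) ≤ Y i ω := by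
    intro i
    by_contra! hc
    exact (ha (Y i ω) (Finset.mem_Ico.2 hc)).1 (Finset.mem_image_of_mem _ i.2)
  obtain ⟨-, -, k, hk, hak⟩ := ha (a + j) (by simp)
  obtain ⟨i, hi, rfl⟩ := Finset.mem_image.1 hk
  refine ⟨fun i => Nat.zero_le _, a, Nat.zero_le _, hempty, ⟨i, hi⟩, ?_⟩
  have := hempty ⟨i, hi⟩
  simp only at this ⊢
  omega

end IsIIDGeometric

/-- The probability that the maximum of `m + 1` independent geometric variables of parameter
`1 - q` is attained only once. -/
noncomputable def uniqueMaxProb (q : ℝ) (m : ℕ) : ℝ :=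
  (m + 1) * (1 - q) * ∑' k : ℕ, q ^ k * (1 - q ^ k) ^ m

section uniqueMaxProb

variable {q : ℝ}

theorem summable_pow_mul_one_sub_pow (h0 : 0 ≤ q) (h1 : q < 1) (m : ℕ) :
    Summable fun k : ℕ => q ^ k * (1 - q ^ k) ^ m := by
  refine (summable_geometric_of_lt_one h0 h1).of_nonneg_of_le (fun k => ?_) fun k => ?_
  · have : q ^ k ≤ 1 := pow_le_one₀ h0 h1.le
    exact mul_nonneg (pow_nonneg h0 _) (pow_nonneg (by linarith) _)
  · have : q ^ k ≤ 1 := pow_le_one₀ h0 h1.le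
    have h2 : 0 ≤ q ^ k := pow_nonneg h0 k
    exact mul_le_of_le_one_right h2 (pow_le_one₀ (by linarith) (by linarith))

theorem uniqueMaxProb_zero (h0 : 0 ≤ q) (h1 : q < 1) : uniqueMaxProb q 0 = 1 := by
  have : 1 - q ≠ 0 := by linarith
  simp [uniqueMaxProb, tsum_geometric_of_lt_one h0 h1, this]

/-- Conditioning on the number of variables that are positive. -/
theorem uniqueMaxProb_eq_sum (h0 : 0 ≤ q) (h1 : q < 1) {m : ℕ} (hm : m ≠ 0) :
    uniqueMaxProb q m = ∑ l ∈ Finset.range (m + 1),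
      ((m + 1).choose (l + 1) : ℝ) * q ^ (l + 1) * (1 - q) ^ (m - l) * uniqueMaxProb q l := by
  have hs := summable_pow_mul_one_sub_pow h0 h1
  have key : ∑' k : ℕ, q ^ k * (1 - q ^ k) ^ m = ∑ l ∈ Finset.range (m + 1),
      (m.choose l : ℝ) * q ^ (l + 1) * (1 - q) ^ (m - l) *
        ∑' k : ℕ, q ^ k * (1 - q ^ k) ^ l := by
    rw [(hs m).tsum_eq_zero_add]
    simp only [pow_zero, sub_self, zero_pow hm, mul_zero, zero_add, ← tsum_mul_left]
    rw [← Summable.tsum_finsetSum fun l _ => (hs l).mul_left _]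
    congr 1; ext k
    have e : 1 - q ^ (k + 1) = q * (1 - q ^ k) + (1 - q) := by ring
    rw [e, add_pow, Finset.mul_sum]
    refine Finset.sum_congr rfl fun l _ => ?_
    rw [mul_pow]; ring
  rw [uniqueMaxProb, key, Finset.mul_sum]
  refine Finset.sum_congr rfl fun l _ => ?_
  have hc : ((m : ℝ) + 1) * m.choose l = (m + 1).choose (l + 1) * (l + 1) := by
    exact_mod_cast Nat.add_one_mul_choose_eq m l
  rw [uniqueMaxProb]
  linear_combination (1 - q) * q ^ (l + 1) * (1 - q) ^ (m - l) *
    (∑' k : ℕ, q ^ k * (1 - q ^ k) ^ l) * hc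

theorem le_uniqueMaxProb (h0 : 0 < q) (h1 : q < 1) (m : ℕ) :
    2 * q / (1 + q) ≤ uniqueMaxProb q (m + 1) := by
  induction m using Nat.strong_induction_on with
  | _ m ih =>
  have hp : 0 < 1 - q := by linarith
  set c := 2 * q / (1 + q) with hc
  have hc1 : (1 - c) * (1 + q) = 1 - q := by rw [hc]; field_simp; ring
  have hc2 : c * (1 + q) = 2 * q := by rw [hc]; field_simp
  set B : ℕ → ℝ := fun l => ((m + 2).choose (l + 1) : ℝ) * q ^ (l + 1) * (1 - q) ^ (m + 1 - l)
    with hB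
  have hrec : uniqueMaxProb q (m + 1) = ∑ l ∈ Finset.range (m + 2), B l * uniqueMaxProb q l :=
    uniqueMaxProb_eq_sum h0.le h1 (Nat.succ_ne_zero m)
  have hbin : ∑ l ∈ Finset.range (m + 2), B l = 1 - (1 - q) ^ (m + 2) := by
    have := add_pow q (1 - q) (m + 2)
    rw [Finset.sum_range_succ'] at this
    simp only [add_sub_cancel, one_pow, pow_zero, Nat.sub_zero, one_mul, Nat.choose_zero_right,
      Nat.cast_one, mul_one] at this
    refine eq_sub_of_add_eq (Eq.trans ?_ this.symm)
    congr 1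
    refine Finset.sum_congr rfl fun l _ => ?_
    rw [hB, show m + 2 - (l + 1) = m + 1 - l by omega]; ring
  have hsplit : ∑ l ∈ Finset.range (m + 2), B l * (uniqueMaxProb q l - c) =
      ∑ l ∈ Finset.range m, B (l + 1) * (uniqueMaxProb q (l + 1) - c) + B 0 * (1 - c) +
        q ^ (m + 2) * (uniqueMaxProb q (m + 1) - c) := by
    rw [Finset.sum_range_succ, Finset.sum_range_succ', uniqueMaxProb_zero h0.le h1]
    simp [hB]
  have hnonneg : 0 ≤ ∑ l ∈ Finset.range m, B (l + 1) * (uniqueMaxProb q (l + 1) - c) :=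
    Finset.sum_nonneg fun l hl => mul_nonneg (by positivity)
      (sub_nonneg.2 (ih l (Finset.mem_range.1 hl)))
  have hB0 : B 0 = (m + 2) * q * (1 - q) ^ (m + 1) := by simp [hB]
  simp only [mul_sub, Finset.sum_sub_distrib, ← Finset.sum_mul, hbin, ← hrec] at hsplit
  simp only [mul_sub, Finset.sum_sub_distrib, ← Finset.sum_mul] at hnonneg
  have hge : c * (1 - q) ^ (m + 2) ≤ B 0 * (1 - c) := by
    refine le_of_mul_le_mul_right ?_ (show 0 < 1 + q by linarith)
    rw [mul_assoc (B 0), hc1, mul_right_comm, hc2, hB0]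
    have : 0 ≤ (m : ℝ) * q * (1 - q) ^ (m + 2) := by positivity
    rw [show (m + 2 : ℝ) * q * (1 - q) ^ (m + 1) * (1 - q) =
      m * q * (1 - q) ^ (m + 2) + 2 * q * (1 - q) ^ (m + 2) by ring]
    linarith
  have hq : 0 < 1 - q ^ (m + 2) := sub_pos.2 (pow_lt_one₀ h0.le h1 (by omega))
  have : 0 ≤ (uniqueMaxProb q (m + 1) - c) * (1 - q ^ (m + 2)) := by nlinarith
  linarith [nonneg_of_mul_nonneg_left this hq]

end uniqueMaxProb

theorem longestGap_image_ge {n i k j : ℕ} {y : ℕ → ℕ} (hn : 2 ≤ n) (hi : i < n)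
    (hyi : y i = k + j) (hy : ∀ l < n, l ≠ i → y l < k) :
    j ≤ longestGap ((Finset.range n).image y) := by
  refine le_longestGap (a := k) fun b hb => ⟨fun hmem => ?_, ?_, k + j, ?_, ?_⟩
  · rw [Finset.mem_Ico] at hb
    obtain ⟨l, hl, rfl⟩ := Finset.mem_image.1 hmem
    rcases eq_or_ne l i with rfl | hne
    · omega
    · have := hy l (Finset.mem_range.1 hl) hne
      omega
  · rw [Finset.mem_Ico] at hb
    obtain ⟨l, hl, hne⟩ : ∃ l < n, l ≠ i := by
      rcases eq_or_ne i 0 with rfl | h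
      · exact ⟨1, by omega, one_ne_zero⟩
      · exact ⟨0, by omega, h.symm⟩
    exact ⟨y l, Finset.mem_image_of_mem _ (Finset.mem_range.2 hl), (hy l hl hne).le.trans hb.1⟩
  · exact hyi ▸ Finset.mem_image_of_mem _ (Finset.mem_range.2 hi)
  · exact (Finset.mem_Ico.1 hb).2.le

namespace IsIIDGeometric

variable {Ω : Type*} [MeasurableSpace Ω] {μ : Measure Ω} {Y : ℕ → Ω → ℕ} {p : ℝ}

theorem real_uniqueMax (h : IsIIDGeometric μ Y p) {m i : ℕ} (hi : i ∈ Finset.range (m + 1))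
    (k j : ℕ) :
    μ.real {ω | ∀ l ∈ Finset.range (m + 1), Y l ω ∈ if l = i then {k + j} else Iio k} =
      (1 - p) ^ j * p * ((1 - p) ^ k * (1 - (1 - p) ^ k) ^ m) := by
  rw [h.real_forall _ fun l => if l = i then {k + j} else Iio k,
    ← Finset.mul_prod_erase _ _ hi, Finset.prod_congr rfl (g := fun _ => 1 - (1 - p) ^ k)]
  · simp only [if_true, mem_singleton_iff, h.law, Finset.prod_const, Finset.card_erase_of_mem hi,
      Finset.card_range, Nat.add_sub_cancel]
    ring
  · intro l hl
    simp only [if_neg (Finset.ne_of_mem_erase hl), mem_Iio, h.real_lt]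

theorem le_real_longestGap (h : IsIIDGeometric μ Y p) (hp : p ∈ Ioo (0 : ℝ) 1) {n : ℕ}
    (hn : 2 ≤ n) (j : ℕ) :
    2 * (1 - p) / (2 - p) * (1 - p) ^ j ≤
      μ.real {ω | j ≤ longestGap ((Finset.range n).image fun i => Y i ω)} := by
  have := h.isProbabilityMeasure
  have hq0 : 0 < 1 - p := by linarith [hp.2]
  have hq1 : 1 - p < 1 := by linarith [hp.1]
  obtain ⟨m, rfl⟩ : ∃ m, n = m + 2 := ⟨n - 2, by omega⟩
  let E : ℕ × ℕ → Set Ω := fun x =>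
    {ω | ∀ l ∈ Finset.range (m + 2), Y l ω ∈ if l = x.1 then {x.2 + j} else Iio x.2}
  have hmeas : ∀ x, MeasurableSet (E x) := by
    intro x
    have : E x = ⋂ l ∈ Finset.range (m + 2), Y l ⁻¹' if l = x.1 then {x.2 + j} else Iio x.2 := by
      ext; simp [E]
    rw [this]
    exact Finset.measurableSet_biInter _ fun l _ => h.measurable l MeasurableSet.of_discrete
  have hE : ∀ x, x.1 ∈ Finset.range (m + 2) → ∀ ω ∈ E x,
      Y x.1 ω = x.2 + j ∧ ∀ l < m + 2, l ≠ x.1 → Y l ω < x.2 := by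
    intro x hx ω hω
    refine ⟨by simpa using hω x.1 hx, fun l hl hne => ?_⟩
    simpa [hne] using hω l (Finset.mem_range.2 hl)
  have hfin : ∀ K, ∑ k ∈ Finset.range K, ((m + 2) * ((1 - p) ^ j * p)) *
      ((1 - p) ^ k * (1 - (1 - p) ^ k) ^ (m + 1)) ≤
      μ.real {ω | j ≤ longestGap ((Finset.range (m + 2)).image fun i => Y i ω)} := by
    intro K
    have hsub : ⋃ x ∈ Finset.range (m + 2) ×ˢ Finset.range K, E x ⊆
        {ω | j ≤ longestGap ((Finset.range (m + 2)).image fun i => Y i ω)} := by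
      intro ω hω
      simp only [mem_iUnion] at hω
      obtain ⟨x, hx, hω⟩ := hω
      have hx1 := (Finset.mem_product.1 hx).1
      have := hE x hx1 ω hω
      exact longestGap_image_ge hn (Finset.mem_range.1 hx1) this.1 this.2
    refine le_of_eq_of_le ?_ (measureReal_mono hsub)
    rw [measureReal_biUnion_finset ?_ fun x _ => hmeas x, Finset.sum_product_right]
    · refine Finset.sum_congr rfl fun k _ => ?_
      rw [Finset.sum_congr rfl fun i hi => h.real_uniqueMax hi k j]
      simp only [Finset.sum_const, Finset.card_range, nsmul_eq_mul]
      push_cast; ring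
    · rintro ⟨i, k⟩ hx ⟨i', k'⟩ hx' hne
      refine Set.disjoint_left.2 fun ω h1 h2 => hne ?_
      have hi := (Finset.mem_product.1 hx).1
      have hi' := (Finset.mem_product.1 hx').1
      obtain ⟨a1, b1⟩ := hE _ hi ω h1
      obtain ⟨a2, b2⟩ := hE _ hi' ω h2
      rw [Finset.mem_range] at hi hi'
      simp only at a1 a2 b1 b2 hi hi'
      rcases eq_or_ne i i' with rfl | hii
      · rw [Prod.mk.injEq]; omega
      · have := b1 i' hi' hii.symm
        have := b2 i hi hii
        omega
  have htsum := Real.tsum_le_of_sum_range_le (fun k => ?_) hfin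
  · rw [tsum_mul_left] at htsum
    have hle := mul_le_mul_of_nonneg_right (le_uniqueMaxProb hq0 hq1 m) (pow_nonneg hq0.le j)
    rw [uniqueMaxProb, show (1 : ℝ) + (1 - p) = 2 - p by ring] at hle
    push_cast at hle
    refine hle.trans (le_of_eq_of_le ?_ htsum)
    ring
  · have : (1 - p) ^ k ≤ 1 := pow_le_one₀ hq0.le hq1.le
    have := hp.1
    have : 0 ≤ 1 - (1 - p) ^ k := by linarith
    positivity

end IsIIDGeometric

/-- The expectation of a sum up to a random integer, in terms of the tail probabilities. -/
theorem integrable_and_hasSum_integral_sum_range {Ω : Type*} [MeasurableSpace Ω] {μ : Measure Ω}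
    [IsFiniteMeasure μ] {X : Ω → ℕ} (hX : Measurable X) {w : ℕ → ℝ} (hw : ∀ j, 0 ≤ w j)
    (hs : Summable fun j => w j * μ.real {ω | j + 1 ≤ X ω}) :
    Integrable (fun ω => ∑ j ∈ Finset.range (X ω), w j) μ ∧
      HasSum (fun j => w j * μ.real {ω | j + 1 ≤ X ω})
        (∫ ω, ∑ j ∈ Finset.range (X ω), w j ∂μ) := by
  have hmeas : ∀ j, MeasurableSet {ω | j + 1 ≤ X ω} := fun j =>
    hX (measurableSet_Ici (a := j + 1))
  have hnn : ∀ ω, 0 ≤ ∑ j ∈ Finset.range (X ω), w j := fun ω => Finset.sum_nonneg fun j _ => hw j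
  have haes : AEStronglyMeasurable (fun ω => ∑ j ∈ Finset.range (X ω), w j) μ :=
    ((Measurable.of_discrete (f := fun n : ℕ => ∑ j ∈ Finset.range n, w j)).comp
      hX).aestronglyMeasurable
  have hpt : ∀ ω, ENNReal.ofReal (∑ j ∈ Finset.range (X ω), w j) =
      ∑' j, ({ω | j + 1 ≤ X ω}.indicator (fun _ => ENNReal.ofReal (w j)) ω) := by
    intro ω
    rw [ENNReal.ofReal_sum_of_nonneg fun j _ => hw j,
      tsum_eq_sum (s := Finset.range (X ω)) fun j hj => ?_]
    · refine Finset.sum_congr rfl fun j hj => ?_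
      rw [Set.indicator_of_mem]
      exact Finset.mem_range.1 hj
    · rw [Set.indicator_of_notMem]
      exact fun h => hj (Finset.mem_range.2 h)
  have hlin : ∫⁻ ω, ENNReal.ofReal (∑ j ∈ Finset.range (X ω), w j) ∂μ =
      ENNReal.ofReal (∑' j, w j * μ.real {ω | j + 1 ≤ X ω}) := by
    simp_rw [hpt]
    rw [lintegral_tsum fun j => (measurable_const.indicator (hmeas j)).aemeasurable,
      ENNReal.ofReal_tsum_of_nonneg (fun j => mul_nonneg (hw j) measureReal_nonneg) hs]
    congr 1; ext j
    rw [lintegral_indicator_const (hmeas j), ENNReal.ofReal_mul (hw j), ofReal_measureReal]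
  refine ⟨⟨haes, ?_⟩, ?_⟩
  · rw [hasFiniteIntegral_iff_ofReal (ae_of_all _ hnn), hlin]
    exact ENNReal.ofReal_lt_top
  · rw [integral_eq_lintegral_of_nonneg_ae (ae_of_all _ hnn) haes, hlin, ENNReal.toReal_ofReal
      (tsum_nonneg fun j => mul_nonneg (hw j) measureReal_nonneg)]
    exact hs.hasSum

theorem hasSum_odd_mul_geometric {r : ℝ} (h0 : 0 ≤ r) (h1 : r < 1) :
    HasSum (fun j : ℕ => (2 * (j : ℝ) + 1) * r ^ (j + 1)) (r * (1 + r) / (1 - r) ^ 2) := by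
  have ha := hasSum_coe_mul_geometric_of_norm_lt_one (𝕜 := ℝ) (r := r)
    (by rwa [Real.norm_of_nonneg h0])
  have hb := hasSum_geometric_of_lt_one h0 h1
  have hne : 1 - r ≠ 0 := by linarith
  have he : r * (1 + r) / (1 - r) ^ 2 = 2 * r * (r / (1 - r) ^ 2) + r * (1 - r)⁻¹ := by
    field_simp; ring
  rw [he]
  have hf : (fun j : ℕ => (2 * (j : ℝ) + 1) * r ^ (j + 1)) =
      fun j : ℕ => 2 * r * ((j : ℝ) * r ^ j) + r * r ^ j := by
    funext j; ring
  rw [hf]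
  exact (ha.mul_left (2 * r)).add (hb.mul_left r)

theorem hasSum_geometric_succ {r : ℝ} (h0 : 0 ≤ r) (h1 : r < 1) :
    HasSum (fun j : ℕ => r ^ (j + 1)) (r / (1 - r)) := by
  rw [div_eq_mul_inv]
  simp only [pow_succ']
  exact (hasSum_geometric_of_lt_one h0 h1).mul_left r

theorem sum_range_odd (n : ℕ) : ∑ j ∈ Finset.range n, (2 * (j : ℝ) + 1) = (n : ℝ) ^ 2 := by
  induction n with
  | zero => simp
  | succ n ih => rw [Finset.sum_range_succ, ih]; push_cast; ring

theorem longestGap_image_range_one (y : ℕ → ℕ) :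
    longestGap ((Finset.range 1).image y) = 0 := by
  by_contra h
  obtain ⟨a, ha⟩ := exists_isGap_of_le_longestGap (Nat.one_le_iff_ne_zero.2 h)
  obtain ⟨h1, ⟨i, hi, hia⟩, k, hk, hak⟩ := ha a (by simp)
  simp only [Finset.range_one, Finset.image_singleton, Finset.mem_singleton] at h1 hi hk
  omega

theorem gapLength_one {Ω : Type*} (Y : ℕ → Ω → ℕ) : gapLength Y 1 = 0 := by
  funext ω
  rw [gapLength, longestGap_image_range_one, Nat.cast_zero, Pi.zero_apply]

namespace IsIIDGeometric

variable {Ω : Type*} [MeasurableSpace Ω] {μ : Measure Ω} {Y : ℕ → Ω → ℕ} {p : ℝ}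

/-- Bounds for the moments of `longestGap` obtained from the bounds for its tail. -/
theorem integrable_and_integral_sum_range_bounds (h : IsIIDGeometric μ Y p)
    (hp : p ∈ Ioo (0 : ℝ) 1) (n : ℕ) {w : ℕ → ℝ} (hw : ∀ j, 0 ≤ w j) {A B : ℝ}
    (hA : HasSum (fun j => w j * (1 - p) ^ (j + 1)) A)
    (hB : HasSum (fun j => w j * ((1 - p) ^ 2) ^ (j + 1)) B) :
    let f := fun ω => ∑ j ∈ Finset.range
      (longestGap ((Finset.range n).image fun i => Y i ω)), w j
    Integrable f μ ∧ ∫ ω, f ω ∂μ ≤ A + B ∧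
      (2 ≤ n → 2 * (1 - p) / (2 - p) * A ≤ ∫ ω, f ω ∂μ) := by
  have := h.isProbabilityMeasure
  have hle : ∀ j, w j * μ.real {ω | j + 1 ≤ longestGap ((Finset.range n).image fun i => Y i ω)} ≤
      w j * (1 - p) ^ (j + 1) + w j * ((1 - p) ^ 2) ^ (j + 1) := by
    intro j
    rw [← mul_add, ← pow_mul, mul_comm 2, pow_mul]
    exact mul_le_mul_of_nonneg_left (h.real_longestGap_le hp n j) (hw j)
  have hs := (hA.add hB).summable.of_nonneg_of_le
    (fun j => mul_nonneg (hw j) measureReal_nonneg) hle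
  obtain ⟨hi, hsum⟩ := integrable_and_hasSum_integral_sum_range (h.measurable_longestGap n) hw hs
  refine ⟨hi, hasSum_le hle hsum (hA.add hB), fun hn => ?_⟩
  refine hasSum_le (fun j => ?_) (hA.mul_left (2 * (1 - p) / (2 - p))) hsum
  rw [mul_left_comm]
  exact mul_le_mul_of_nonneg_left (h.le_real_longestGap hp hn (j + 1)) (hw j)

theorem integrable_sq_gapLength (h : IsIIDGeometric μ Y p) (hp : p ∈ Ioo (0 : ℝ) 1) (n : ℕ) :
    Integrable (fun ω => gapLength Y n ω ^ 2) μ ∧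
      ∫ ω, gapLength Y n ω ^ 2 ∂μ ≤ (1 - p) * (2 - p) / p ^ 2 +
        (1 - p) ^ 2 * (1 + (1 - p) ^ 2) / (p * (2 - p)) ^ 2 ∧
      (2 ≤ n → 2 * (1 - p) ^ 2 / p ^ 2 ≤ ∫ ω, gapLength Y n ω ^ 2 ∂μ) := by
  have hq0 : 0 < 1 - p := by linarith [hp.2]
  have hq1 : 1 - p < 1 := by linarith [hp.1]
  have hp0 := hp.1.ne'
  have hp2 : 2 - p ≠ 0 := by linarith
  have e1 : 1 - (1 - p) = p := by ring
  have e2 : 1 - (1 - p) ^ 2 = p * (2 - p) := by ring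
  have e3 : 1 + (1 - p) = 2 - p := by ring
  have := h.integrable_and_integral_sum_range_bounds hp n (w := fun j => 2 * (j : ℝ) + 1)
    (fun j => by positivity) (hasSum_odd_mul_geometric hq0.le hq1)
    (hasSum_odd_mul_geometric (r := (1 - p) ^ 2) (by positivity) (by nlinarith))
  simp only [sum_range_odd, e1, e2, e3] at this
  refine ⟨this.1, this.2.1, fun hn => le_of_eq_of_le ?_ (this.2.2 hn)⟩
  field_simp

theorem integral_gapLength_bounds (h : IsIIDGeometric μ Y p) (hp : p ∈ Ioo (0 : ℝ) 1) (n : ℕ) :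
    ∫ ω, gapLength Y n ω ∂μ ≤ (1 - p) / p + (1 - p) ^ 2 / (p * (2 - p)) ∧
      (2 ≤ n → 2 * (1 - p) ^ 2 / (p * (2 - p)) ≤ ∫ ω, gapLength Y n ω ∂μ) := by
  have hq0 : 0 < 1 - p := by linarith [hp.2]
  have hq1 : 1 - p < 1 := by linarith [hp.1]
  have hp0 := hp.1.ne'
  have hp2 : 2 - p ≠ 0 := by linarith
  have e1 : 1 - (1 - p) = p := by ring
  have e2 : 1 - (1 - p) ^ 2 = p * (2 - p) := by ring
  have e3 : 1 + (1 - p) = 2 - p := by ring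
  have := (h.integrable_and_integral_sum_range_bounds hp n (w := fun _ => 1)
    (fun j => zero_le_one) (by simpa only [one_mul] using hasSum_geometric_succ hq0.le hq1)
    (by simpa only [one_mul] using
      hasSum_geometric_succ (pow_nonneg hq0.le 2) (pow_lt_one₀ hq0.le hq1 two_ne_zero))).2
  simp only [Finset.sum_const, Finset.card_range, nsmul_eq_mul, mul_one, e1, e2] at this
  refine ⟨this.1, fun hn => le_of_eq_of_le ?_ (this.2 hn)⟩
  field_simp

end IsIIDGeometric

theorem AsympMem.of_eventually {α : Type*} {F : Filter α} {f lo hi : α → ℝ}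
    (h : ∀ᶠ x in F, lo x ≤ f x ∧ f x ≤ hi x) : AsympMem F f lo hi := by
  intro ε hε
  filter_upwards [h] with x hx
  have h1 : 0 ≤ ε * |lo x| := by positivity
  have h2 : 0 ≤ ε * |hi x| := by positivity
  exact ⟨by linarith, by linarith⟩

namespace IsIIDGeometric

variable {Ω : Type*} [MeasurableSpace Ω] {μ : Measure Ω} {Y : ℕ → Ω → ℕ} {p : ℝ}

theorem memLp_gapLength (h : IsIIDGeometric μ Y p) (hp : p ∈ Ioo (0 : ℝ) 1) (n : ℕ) :
    MemLp (gapLength Y n) 2 μ := by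
  have hm : Measurable (gapLength Y n) :=
    (Measurable.of_discrete (f := fun k : ℕ => (k : ℝ))).comp (h.measurable_longestGap n)
  exact (memLp_two_iff_integrable_sq hm.aestronglyMeasurable).2 (h.integrable_sq_gapLength hp n).1

theorem integral_gapLength_nonneg (μ : Measure Ω) (Y : ℕ → Ω → ℕ) (n : ℕ) :
    0 ≤ ∫ ω, gapLength Y n ω ∂μ :=
  integral_nonneg fun _ => Nat.cast_nonneg _

theorem integral_gapLength_le (h : IsIIDGeometric μ Y p) (hp : p ∈ Ioo (0 : ℝ) 1) (n : ℕ) :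
    ∫ ω, gapLength Y n ω ∂μ ≤ 1.5 / p := by
  obtain ⟨hp0, hp1⟩ := hp
  refine (h.integral_gapLength_bounds ⟨hp0, hp1⟩ n).1.trans ?_
  have hp2 : 0 < 2 - p := by linarith
  have e : (1 - p) ^ 2 / (p * (2 - p)) ≤ 0.5 / p := by
    rw [div_le_div_iff₀ (by positivity) hp0]
    nlinarith [mul_pos hp0 hp0, mul_pos hp0 hp2, mul_pos (mul_pos hp0 hp0) hp2]
  have e' : (1 - p) / p ≤ 1 / p := by gcongr; linarith
  calc _ ≤ 1 / p + 0.5 / p := add_le_add e' e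
    _ = 1.5 / p := by ring

theorem le_integral_gapLength (h : IsIIDGeometric μ Y p) (hp : p ∈ Ioo (0 : ℝ) 1) {n : ℕ}
    (hn : 2 ≤ n) : (1 - p) ^ 2 / p ≤ ∫ ω, gapLength Y n ω ∂μ := by
  obtain ⟨hp0, hp1⟩ := hp
  refine le_trans ?_ ((h.integral_gapLength_bounds ⟨hp0, hp1⟩ n).2 hn)
  have hp2 : 0 < 2 - p := by linarith
  rw [div_le_div_iff₀ hp0 (by positivity)]
  have : 0 ≤ (1 - p) ^ 2 * p * p := by positivity
  linarith

theorem integral_sq_gapLength_le (h : IsIIDGeometric μ Y p) (hp : p ∈ Ioo (0 : ℝ) 1) (n : ℕ) :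
    ∫ ω, gapLength Y n ω ^ 2 ∂μ ≤ 2.5 / p ^ 2 := by
  obtain ⟨hp0, hp1⟩ := hp
  refine (h.integrable_sq_gapLength ⟨hp0, hp1⟩ n).2.1.trans ?_
  have hp2 : 0 < 2 - p := by linarith
  obtain ⟨q, rfl⟩ : ∃ q, p = 1 - q := ⟨1 - p, by ring⟩
  have hq : 0 < q := by linarith
  have hq1 : q < 1 := by linarith
  have e1 : (1 - (1 - q)) * (2 - (1 - q)) ≤ 2 := by nlinarith
  have e2 : (1 - (1 - q)) ^ 2 * (1 + (1 - (1 - q)) ^ 2) / (2 - (1 - q)) ^ 2 ≤ 0.5 := by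
    rw [div_le_iff₀ (by positivity)]
    have h2 : q ^ 2 ≤ q := by nlinarith
    have h4 : q ^ 2 * q ^ 2 ≤ q * 1 := mul_le_mul h2 (by nlinarith) (by positivity) hq.le
    nlinarith
  rw [mul_pow, mul_comm ((1 - q) ^ 2), ← div_div, ← add_div]
  gcongr
  linarith

theorem le_integral_sq_gapLength (h : IsIIDGeometric μ Y p) (hp : p ∈ Ioo (0 : ℝ) 1) {n : ℕ}
    (hn : 2 ≤ n) : 2 * (1 - p) ^ 2 / p ^ 2 ≤ ∫ ω, gapLength Y n ω ^ 2 ∂μ :=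
  (h.integrable_sq_gapLength hp n).2.2 hn

theorem variance_gapLength_eq (h : IsIIDGeometric μ Y p) (hp : p ∈ Ioo (0 : ℝ) 1) (n : ℕ) :
    variance (gapLength Y n) μ =
      ∫ ω, gapLength Y n ω ^ 2 ∂μ - (∫ ω, gapLength Y n ω ∂μ) ^ 2 := by
  have := h.isProbabilityMeasure
  exact variance_eq_sub (h.memLp_gapLength hp n)

theorem variance_gapLength_le (h : IsIIDGeometric μ Y p) (hp : p ∈ Ioo (0 : ℝ) 1) {n : ℕ}
    (hn : 1 ≤ n) : variance (gapLength Y n) μ ≤ 2.3 / p ^ 2 := by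
  obtain rfl | hn : n = 1 ∨ 2 ≤ n := by omega
  · rw [gapLength_one, variance_zero]; positivity
  obtain ⟨hp0, hp1⟩ := hp
  rw [h.variance_gapLength_eq ⟨hp0, hp1⟩]
  have h2 := (h.integrable_sq_gapLength ⟨hp0, hp1⟩ n).2.1
  have h1 := (h.integral_gapLength_bounds ⟨hp0, hp1⟩ n).2 hn
  have hp2 : 0 < 2 - p := by linarith
  have h3 := pow_le_pow_left₀ (by positivity) h1 2
  refine (sub_le_sub h2 h3).trans ?_
  obtain ⟨q, rfl⟩ : ∃ q, p = 1 - q := ⟨1 - p, by ring⟩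
  have hq : 0 < q := by linarith
  have hq1 : q < 1 := by linarith
  have e : (1 - (1 - q)) * (2 - (1 - q)) / (1 - q) ^ 2 + (1 - (1 - q)) ^ 2 *
      (1 + (1 - (1 - q)) ^ 2) / ((1 - q) * (2 - (1 - q))) ^ 2 -
      (2 * (1 - (1 - q)) ^ 2 / ((1 - q) * (2 - (1 - q)))) ^ 2 =
      (q * (1 + q) + (q ^ 2 - 3 * q ^ 4) / (1 + q) ^ 2) / (1 - q) ^ 2 := by
    have : 1 + q ≠ 0 := by linarith
    rw [show 2 - (1 - q) = 1 + q by ring, sub_sub_cancel]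
    field_simp
    ring
  rw [e]
  have e1 : q * (1 + q) ≤ 2 := by nlinarith
  have e2 : (q ^ 2 - 3 * q ^ 4) / (1 + q) ^ 2 ≤ 0.25 := by
    rw [div_le_iff₀ (by positivity)]
    have : 0 ≤ q ^ 4 := by positivity
    nlinarith
  gcongr
  linarith

end IsIIDGeometric

theorem pow_two_mul_div_le {q : ℝ} (h0 : 0 < q) (h1 : q < 1) {n : ℕ} (hn : 1 ≤ n) :
    0 ≤ q ^ (2 * n) / (1 - q ^ n) ∧ q ^ (2 * n) / (1 - q ^ n) ≤ q ^ 2 / (1 - q) := by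
  have hle : q ^ n ≤ q := pow_le_of_le_one h0.le h1.le (by omega)
  have h2 : 0 < 1 - q := by linarith
  have h3 : 0 < 1 - q ^ n := by linarith
  refine ⟨by positivity, ?_⟩
  rw [mul_comm, pow_mul]
  gcongr

theorem mainTheorem12 {Ω : ℝ → Type*} [∀ p, MeasurableSpace (Ω p)]
    (μ : ∀ p, Measure (Ω p)) (Y : ∀ p, ℕ → Ω p → ℕ)
    (hY : ∀ p ∈ Ioo (0 : ℝ) 1, IsIIDGeometric (μ p) (Y p) p) :
    -- bounds for every sample size and every parameter
    (∀ p ∈ Ioo (0 : ℝ) 1, ∀ n : ℕ, 1 ≤ n →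
      MemLp (gapLength (Y p) n) 2 (μ p) ∧
      (∫ ω, gapLength (Y p) n ω ∂(μ p)) ∈
        Icc ((1 - p) ^ 2 / p - (1 - p) ^ (2 * n) / (1 - (1 - p) ^ n)) (1.5 / p + 1) ∧
      (∫ ω, gapLength (Y p) n ω ^ 2 ∂(μ p)) ∈
        Icc (2 * (1 - p) ^ 2 / p ^ 2 - 2 * (1 - p) ^ (2 * n) / (1 - (1 - p) ^ n) ^ 2)
          (3.3 / p ^ 2 + 3 / (2 * p) + 2) ∧
      variance (gapLength (Y p) n) (μ p) ∈
        Icc 0 (3.3 / p ^ 2 + 3 / (2 * p) + 2 -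
          ((1 - p) ^ 2 / p - (1 - p) ^ (2 * n) / (1 - (1 - p) ^ n)) ^ 2)) ∧
    -- fixed parameter, sample size tending to infinity
    (∀ p ∈ Ioo (0 : ℝ) 1,
      AsympMem atTop (fun n : ℕ => ∫ ω, gapLength (Y p) n ω ∂(μ p))
        (fun _ => (1 - p) ^ 2 / p) (fun _ => 1.5 / p + 1) ∧
      AsympMem atTop (fun n : ℕ => ∫ ω, gapLength (Y p) n ω ^ 2 ∂(μ p))
        (fun _ => 2 * (1 - p) ^ 2 / p ^ 2) (fun _ => 3.3 / p ^ 2 + 3 / (2 * p) + 2) ∧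
      AsympMem atTop (fun n : ℕ => variance (gapLength (Y p) n) (μ p))
        (fun _ => 0) (fun _ => 2.3 / p ^ 2 + 5.5 / p)) ∧
    -- fixed sample size, parameter tending to 0 from above
    (∀ n : ℕ, 1 ≤ n →
      AsympMem (𝓝[>] (0 : ℝ)) (fun p => ∫ ω, gapLength (Y p) n ω ∂(μ p))
        (fun p => ((n : ℝ) - 1) / (n * p)) (fun p => 1.5 / p) ∧
      AsympMem (𝓝[>] (0 : ℝ)) (fun p => ∫ ω, gapLength (Y p) n ω ^ 2 ∂(μ p))
        (fun p => (2 * (n : ℝ) ^ 2 * (1 - p) ^ 2 - 2) / ((n : ℝ) ^ 2 * p ^ 2))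
        (fun p => 3.3 / p ^ 2) ∧
      AsympMem (𝓝[>] (0 : ℝ)) (fun p => variance (gapLength (Y p) n) (μ p))
        (fun _ => 0)
        (fun p => (2.3 * (n : ℝ) ^ 2 + 2 * (n : ℝ) - 1) / ((n : ℝ) ^ 2 * p ^ 2))) ∧
    -- fixed sample size, parameter tending to 1 from below
    (∀ n : ℕ, 1 ≤ n →
      AsympMem (𝓝[<] (1 : ℝ)) (fun p => ∫ ω, gapLength (Y p) n ω ∂(μ p))
        (fun _ => 0) (fun _ => 2.5) ∧
      AsympMem (𝓝[<] (1 : ℝ)) (fun p => ∫ ω, gapLength (Y p) n ω ^ 2 ∂(μ p))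
        (fun _ => 0) (fun _ => 6.8) ∧
      AsympMem (𝓝[<] (1 : ℝ)) (fun p => variance (gapLength (Y p) n) (μ p))
        (fun _ => 0) (fun _ => 6.8)) := by
  have hsq : ∀ p n, 0 ≤ ∫ ω, gapLength (Y p) n ω ^ 2 ∂(μ p) := fun p n =>
    integral_nonneg fun ω => sq_nonneg _
  have hEX := fun p n => IsIIDGeometric.integral_gapLength_nonneg (μ p) (Y p) n
  have hsqle : ∀ p ∈ Ioo (0 : ℝ) 1, ∀ n,
      ∫ ω, gapLength (Y p) n ω ^ 2 ∂(μ p) ≤ 3.3 / p ^ 2 := by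
    intro p hp n
    refine ((hY p hp).integral_sq_gapLength_le hp n).trans ?_
    gcongr; norm_num
  have hzero : ∀ᶠ p in 𝓝[>] (0 : ℝ), p ∈ Ioo (0 : ℝ) 1 := Ioo_mem_nhdsGT one_pos
  have hone : ∀ᶠ p in 𝓝[<] (1 : ℝ), p ∈ Ioo (0.9 : ℝ) 1 := Ioo_mem_nhdsLT (by norm_num)
  refine ⟨fun p hp n hn => ?_, fun p hp => ⟨?_, ?_, ?_⟩, fun n hn => ⟨?_, ?_, ?_⟩,
    fun n hn => ⟨?_, ?_, ?_⟩⟩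
  · have hp0 := hp.1
    have hq0 : 0 < 1 - p := by linarith [hp.2]
    have hq1 : 1 - p < 1 := by linarith [hp.1]
    have hq := pow_two_mul_div_le hq0 hq1 hn
    rw [sub_sub_cancel] at hq
    have hlow : (1 - p) ^ 2 / p - (1 - p) ^ (2 * n) / (1 - (1 - p) ^ n) ≤
        ∫ ω, gapLength (Y p) n ω ∂(μ p) := by
      obtain rfl | hn2 : n = 1 ∨ 2 ≤ n := by omega
      · refine le_of_eq_of_le ?_ (hEX p 1)
        rw [pow_one, sub_sub_cancel, mul_one, sub_self]
      · linarith [(hY p hp).le_integral_gapLength hp hn2]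
    have hup : ∫ ω, gapLength (Y p) n ω ^ 2 ∂(μ p) ≤ 3.3 / p ^ 2 + 3 / (2 * p) + 2 := by
      have : 0 ≤ 3 / (2 * p) := by positivity
      linarith [hsqle p hp n]
    refine ⟨(hY p hp).memLp_gapLength hp n, ⟨hlow, ?_⟩, ⟨?_, hup⟩, variance_nonneg _ _, ?_⟩
    · linarith [(hY p hp).integral_gapLength_le hp n]
    · obtain rfl | hn2 : n = 1 ∨ 2 ≤ n := by omega
      · refine le_of_eq_of_le ?_ (hsq p 1)
        rw [pow_one, sub_sub_cancel, mul_one, sub_self]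
      · have : 0 ≤ 2 * (1 - p) ^ (2 * n) / (1 - (1 - p) ^ n) ^ 2 := by positivity
        linarith [(hY p hp).le_integral_sq_gapLength hp hn2]
    · rw [(hY p hp).variance_gapLength_eq hp]
      have := pow_le_pow_left₀ (sub_nonneg.2 hq.2) hlow 2
      linarith
  · refine .of_eventually ?_
    filter_upwards [eventually_ge_atTop 2] with n hn
    exact ⟨(hY p hp).le_integral_gapLength hp hn,
      by linarith [(hY p hp).integral_gapLength_le hp n]⟩
  · refine .of_eventually ?_
    filter_upwards [eventually_ge_atTop 2] with n hn
    have hp0 := hp.1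
    have : 0 ≤ 3 / (2 * p) := by positivity
    exact ⟨(hY p hp).le_integral_sq_gapLength hp hn, by linarith [hsqle p hp n]⟩
  · refine .of_eventually ?_
    filter_upwards [eventually_ge_atTop 1] with n hn
    have hp0 := hp.1
    have : 0 ≤ 5.5 / p := by positivity
    exact ⟨variance_nonneg _ _, by linarith [(hY p hp).variance_gapLength_le hp hn]⟩
  · have hn0 : (0 : ℝ) < n := by exact_mod_cast hn
    have hsmall : ∀ᶠ p in 𝓝[>] (0 : ℝ), p ∈ Ioo (0 : ℝ) (1 / (2 * n)) :=
      Ioo_mem_nhdsGT (by positivity)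
    refine .of_eventually ?_
    filter_upwards [hzero, hsmall] with p hp hpn
    refine ⟨?_, (hY p hp).integral_gapLength_le hp n⟩
    have hp0 := hp.1
    obtain rfl | hn2 : n = 1 ∨ 2 ≤ n := by omega
    · simpa using hEX p 1
    · refine le_trans ?_ ((hY p hp).le_integral_gapLength hp hn2)
      rw [← div_div]
      gcongr
      have h1 := (lt_div_iff₀ (by positivity)).1 hpn.2
      rw [div_le_iff₀ hn0]
      nlinarith [mul_nonneg hn0.le (sq_nonneg p)]
  · have hn0 : (0 : ℝ) < n := by exact_mod_cast hn
    refine .of_eventually ?_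
    filter_upwards [hzero] with p hp
    refine ⟨?_, hsqle p hp n⟩
    have hp0 := hp.1
    obtain rfl | hn2 : n = 1 ∨ 2 ≤ n := by omega
    · refine le_trans (div_nonpos_of_nonpos_of_nonneg ?_ (by positivity)) (hsq p 1)
      have := hp.2
      push_cast
      nlinarith
    · refine le_trans ?_ ((hY p hp).le_integral_sq_gapLength hp hn2)
      rw [← div_div]
      gcongr
      rw [div_le_iff₀ (by positivity)]
      linarith
  · have hn0 : (1 : ℝ) ≤ n := by exact_mod_cast hn
    refine .of_eventually ?_
    filter_upwards [hzero] with p hp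
    have hp0 := hp.1
    refine ⟨variance_nonneg _ _, ((hY p hp).variance_gapLength_le hp hn).trans ?_⟩
    rw [← div_div]
    gcongr
    rw [le_div_iff₀ (by positivity)]
    linarith
  all_goals
    refine .of_eventually ?_
    filter_upwards [hone] with p hp
    have hp' : p ∈ Ioo (0 : ℝ) 1 := ⟨by linarith [hp.1], hp.2⟩
    have hp0 := hp'.1
    have hp9 := hp.1
  · refine ⟨hEX p n, ((hY p hp').integral_gapLength_le hp' n).trans ?_⟩
    rw [div_le_iff₀ hp0]
    linarith
  · refine ⟨hsq p n, (hsqle p hp' n).trans ?_⟩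
    rw [div_le_iff₀ (by positivity)]
    nlinarith
  · refine ⟨variance_nonneg _ _, ((hY p hp').variance_gapLength_le hp' hn).trans ?_⟩
    rw [div_le_iff₀ (by positivity)]
    nlinarith
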